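/- \textbf{Theorem (Lasso, support recovery and $\ell_\infty$-error).} Consider the sparse linear model $Y = X\theta^* + \epsilon \in \mathbb{R}^n$ with design matrix $X\in\mathbb{R}^{n\times d}$ and a fixed parameter $\theta^*\in\mathbb{R}^d$. Let $S\subseteq\{1,\dots,d\}$, $s=|S|$, and $\beta>0$ be such that $\theta^*_i=0$ for $i\notin S$ and $|\theta^*_i|\ge \beta$ for $i\in S$. The noise variables $\epsilon_1,\dots,\epsilon_n$ are i.i.d. with mean zero and sub-Gaussian with parameter $\sigma>0$, i.e. $\mathbb{E}\,e^{t\epsilon_i}\le e^{\sigma^2t^2/2}$ for all $t\in\mathbb{R}$. The design $X$ may be random (in particular, it may be deterministic); it is independent of $\epsilon$. Write $x_j$ for the $j$-th column of $X$, $X_S$ for the submatrix of the columns with index in $S$, $V=\frac1n X^\top X$ and $V_S=\frac1n X_S^\top X_S$. Let $C>0$, $\alpha_1<1$, $\alpha_2>0$, $\alpha'\ge 0$, $c_{\min}>0$ be constants such that, almost surely, \begin{enumerate} \item (column normalization) $\max_{j}\|x_j\|_2/\sqrt n\le C$; \item (mutual incoherence) $\max_{j\notin S}\|(X_S^\top X_S)^{-1}X_S^\top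 x_j\|_1\le\alpha_1$; \item (lower eigenvalue) $\lambda_{\min}(V_S)\ge c_{\min}$; \item ($\ell_\infty$-curvature) $\|Vz\|_\infty\ge\alpha_2\|z\|_\infty$ for all $z\in\mathbb{R}^d$ with $\|z_{S^c}\|_1\le\alpha'\|z_S\|_1$. \end{enumerate} Set $$\zeta=\frac14\min\left\{\frac{\sqrt{c_{\min}}}{\sigma\beta},\frac{\alpha_2(1-\alpha_1)}{2C\sigma\beta}\right\},\qquad \lambda_n=\frac{2C\sigma}{1-\alpha_1}\left\{\sqrt{\frac{2\log(d-s)}{n}}+\zeta\right\},$$ $$B_n=\frac{\sigma}{\sqrt{c_{\min}}}\left\{\sqrt{\frac{2\log s}{n}}+\zeta\right\}+\frac{1}{\alpha_2}\lambda_n ,$$ with the convention $\log 0=0$ in the degenerate cases $s=0$ and $s=d$. Then, with probability at least $1-4e^{-n\zeta^2/2}$, the Lagrangian Lasso problem $$\min_{\theta\in\mathbb{R}^d}\ \frac{1}{2n}\|Y-X\theta\|_2^2+\lambda_n\|\theta\|_1$$ has a unique optimal solution $\hat\theta$, its support is contained in $S$, and $\|\hat\theta_S-\theta^*_S\|_\infty\le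 B_n$. -/

import Mathlib

open MeasureTheory ProbabilityTheory

open scoped Matrix

noncomputable section

namespace Lasso

/-- The submatrix `X_S` of the design matrix `X` made of the columns with index in `S`. -/
def colsOn {n d : ℕ} (X : Matrix (Fin n) (Fin d) ℝ) (S : Finset (Fin d)) :
    Matrix (Fin n) S ℝ :=
  X.submatrix id (fun j : S => (j : Fin d))

/-- The matrix `V = (1/n) Xᵀ X`. -/
def gram {n d : ℕ} (X : Matrix (Fin n) (Fin d) ℝ) : Matrix (Fin d) (Fin d) ℝ :=
  (1 / (n : ℝ)) • (Xᵀ * X)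

/-- The matrix `V_S = (1/n) X_Sᵀ X_S`. -/
def gramOn {n d : ℕ} (X : Matrix (Fin n) (Fin d) ℝ) (S : Finset (Fin d)) : Matrix S S ℝ :=
  (1 / (n : ℝ)) • ((colsOn X S)ᵀ * colsOn X S)

theorem gramOn_isHermitian {n d : ℕ} (X : Matrix (Fin n) (Fin d) ℝ) (S : Finset (Fin d)) :
    (gramOn X S).IsHermitian := by
  unfold gramOn Matrix.IsHermitian
  rw [Matrix.conjTranspose_eq_transpose_of_trivial, Matrix.transpose_smul,
    Matrix.transpose_mul, Matrix.transpose_transpose]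

/-- Mutual incoherence: `max_{j ∉ S} ‖(X_Sᵀ X_S)⁻¹ X_Sᵀ x_j‖₁ ≤ α₁`, where `x_j` is the `j`-th
column of `X`. -/
def MutualIncoherence {n d : ℕ} (X : Matrix (Fin n) (Fin d) ℝ) (S : Finset (Fin d))
    (α₁ : ℝ) : Prop :=
  ∀ j, j ∉ S →
    ∑ k : S, |((((colsOn X S)ᵀ * colsOn X S)⁻¹ * (colsOn X S)ᵀ) *ᵥ (fun i => X i j)) k| ≤ α₁

/-- Lower eigenvalue condition: all eigenvalues of the symmetric matrix `V_S` are at least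
`cmin`, that is, `λ_min (V_S) ≥ cmin`. -/
def LowerEigenvalue {n d : ℕ} (X : Matrix (Fin n) (Fin d) ℝ) (S : Finset (Fin d))
    (cmin : ℝ) : Prop :=
  ∀ k : S, cmin ≤ (gramOn_isHermitian X S).eigenvalues k

/-- The cone `C_a(S) = {Δ : ‖Δ_{Sᶜ}‖₁ ≤ a ‖Δ_S‖₁}`. -/
def cone {d : ℕ} (a : ℝ) (S : Finset (Fin d)) : Set (Fin d → ℝ) :=
  {Δ | ∑ j ∈ Sᶜ, |Δ j| ≤ a * ∑ j ∈ S, |Δ j|}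

/-- The `ℓ_∞`-curvature condition: `‖V z‖_∞ ≥ α₂ ‖z‖_∞` for all `z` in the cone `C_a(S)`
(the norm of `Fin d → ℝ` is the sup norm). -/
def SupCurvature {n d : ℕ} (X : Matrix (Fin n) (Fin d) ℝ) (S : Finset (Fin d))
    (a α₂ : ℝ) : Prop :=
  ∀ z ∈ cone a S, α₂ * ‖z‖ ≤ ‖gram X *ᵥ z‖

/-- Column normalization: `max_j ‖x_j‖₂ / √n ≤ C`. -/
def ColumnNormalized {n d : ℕ} (X : Matrix (Fin n) (Fin d) ℝ) (C : ℝ) : Prop :=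
  ∀ j, √(∑ i, X i j ^ 2) / √(n : ℝ) ≤ C

/-- Zero-mean i.i.d. sub-Gaussian noise with parameter `σ`, that is,
`𝔼 exp (t εᵢ) ≤ exp (σ² t² / 2)` for all real `t`. -/
structure IsSubGaussianNoise {Ω : Type*} [MeasurableSpace Ω] (μ : Measure Ω) {n : ℕ}
    (ε : Fin n → Ω → ℝ) (σ : ℝ) : Prop where
  measurable : ∀ i, Measurable (ε i)
  indep : iIndepFun ε μ
  identDistrib : ∀ i j, IdentDistrib (ε i) (ε j) μ μ
  zero_mean : ∀ i, ∫ ω, ε i ω ∂μ = 0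
  subGaussian : ∀ i, HasSubgaussianMGF (ε i) ⟨σ ^ 2, sq_nonneg σ⟩ μ

/-- The Lagrangian Lasso objective `(1/(2n)) ‖y - X θ‖₂² + lam ‖θ‖₁`. -/
def objective {n d : ℕ} (X : Matrix (Fin n) (Fin d) ℝ) (y : Fin n → ℝ) (lam : ℝ)
    (θ : Fin d → ℝ) : ℝ :=
  1 / (2 * (n : ℝ)) * ∑ i, (y i - (X *ᵥ θ) i) ^ 2 + lam * ∑ j, |θ j|

/-- `θ` is an optimal solution of the Lagrangian Lasso. -/
def IsSolution {n d : ℕ} (X : Matrix (Fin n) (Fin d) ℝ) (y : Fin n → ℝ) (lam : ℝ)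
    (θ : Fin d → ℝ) : Prop :=
  ∀ θ' : Fin d → ℝ, objective X y lam θ ≤ objective X y lam θ'

end Lasso

end

namespace Lasso

/-! The proof is a primal-dual witness argument. Minimize the objective over vectors supported in
`S`, and let `r` be the residual `Y - Xθ` at the minimizer `θ`. Optimality on `S` gives `‖X_Sᵀ r‖_∞
≤ n λ`.

For `j ∉ S`, split `x_j` into its projection onto the span of `X_S` and an orthogonal remainder. The
projection contributes at most `α₁ n λ` to `⟨x_j, r⟩` by incoherence. The remainder sees only the
noise, because `r - ε` lies in that span. If this noise term is below `(1 - α₁) n λ`, the optimality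
conditions hold strictly off `S`. Then `θ` solves the full problem, every solution is supported in
`S`, and injectivity of `X_S` gives uniqueness (`isSolution_and_unique`).

For the error, apply `(X_Sᵀ X_S)⁻¹ X_Sᵀ` to `r = X_S (θ* - θ)_S + ε`: the error is a noise term
minus the least squares coefficients of `r`. Curvature bounds the latter by `λ / α₂`
(`SupCurvature.abs_leastSquares_le`).

Both noise requirements concern finitely many sums `∑ W_i ε_i` with weights depending on `X` alone.
Independence reduces them to fixed weights, and each of the two families fails with probability at
most `2 exp (-n ζ² / 2)` by a union bound. -/

/-! ### Measurability of matrix operations -/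

theorem measurable_det {Ω ι : Type*} [MeasurableSpace Ω] [Fintype ι] [DecidableEq ι]
    {M : Ω → Matrix ι ι ℝ} (hM : ∀ i j, Measurable fun ω => M ω i j) :
    Measurable fun ω => (M ω).det := by
  simp only [Matrix.det_apply]
  refine Finset.measurable_sum _ fun σ _ => Measurable.const_smul ?_ _
  exact Finset.measurable_prod _ fun i _ => hM _ _

theorem measurable_inv_apply {Ω ι : Type*} [MeasurableSpace Ω] [Fintype ι] [DecidableEq ι]
    {M : Ω → Matrix ι ι ℝ} (hM : ∀ i j, Measurable fun ω => M ω i j) (i j : ι) :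
    Measurable fun ω => (M ω)⁻¹ i j := by
  simp only [Matrix.inv_def, Matrix.smul_apply, Ring.inverse_eq_inv', Matrix.adjugate_apply,
    smul_eq_mul]
  refine (measurable_det hM).inv.mul (measurable_det fun k l => ?_)
  by_cases hk : k = j
  · subst hk
    simp
  · simpa [Matrix.updateRow_ne hk] using hM k l

theorem measurable_mul_apply {Ω ι κ τ : Type*} [MeasurableSpace Ω] [Fintype κ]
    {M : Ω → Matrix ι κ ℝ} {N : Ω → Matrix κ τ ℝ}
    (hM : ∀ i j, Measurable fun ω => M ω i j) (hN : ∀ i j, Measurable fun ω => N ω i j)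
    (i : ι) (j : τ) : Measurable fun ω => (M ω * N ω) i j := by
  simp only [Matrix.mul_apply]
  exact Finset.measurable_sum _ fun k _ => (hM i k).mul (hN k j)

/-! ### Sub-Gaussian tails and union bounds -/

section Noise

variable {Ω : Type*} [MeasurableSpace Ω] {μ : Measure Ω} {n : ℕ}

theorem hasSubgaussianMGF_mono {Z : Ω → ℝ} {c c' : NNReal} (h : HasSubgaussianMGF Z c μ)
    (hc : c ≤ c') : HasSubgaussianMGF Z c' μ where
  integrable_exp_mul := h.integrable_exp_mul
  mgf_le t := (h.mgf_le t).trans (by gcongr)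

theorem IsSubGaussianNoise.hasSubgaussianMGF_sum {ε : Fin n → Ω → ℝ} {σ : ℝ}
    (hε : IsSubGaussianNoise μ ε σ) (w : Fin n → ℝ) {v : NNReal} (hv : ∑ i, w i ^ 2 ≤ v) :
    HasSubgaussianMGF (fun ω => ∑ i, w i * ε i ω) (⟨σ ^ 2, sq_nonneg σ⟩ * v) μ := by
  have hind : iIndepFun (fun i ω => w i * ε i ω) μ :=
    hε.indep.comp (fun i x => w i * x) fun i => measurable_const_mul (w i)
  refine hasSubgaussianMGF_mono (HasSubgaussianMGF.sum_of_iIndepFun hind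
    (s := Finset.univ) fun i _ => (hε.subGaussian i).const_mul (w i)) ?_
  rw [← NNReal.coe_le_coe, NNReal.coe_sum]
  calc ∑ i, w i ^ 2 * σ ^ 2 = σ ^ 2 * ∑ i, w i ^ 2 := by rw [← Finset.sum_mul, mul_comm]
    _ ≤ σ ^ 2 * v := mul_le_mul_of_nonneg_left hv (sq_nonneg σ)

theorem IsSubGaussianNoise.measureReal_lt_abs_sum_le [IsProbabilityMeasure μ]
    {ε : Fin n → Ω → ℝ} {σ : ℝ}
    (hε : IsSubGaussianNoise μ ε σ) (w : Fin n → ℝ) {v τ : ℝ} (hw : ∑ i, w i ^ 2 ≤ v)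
    (hτ : 0 ≤ τ) :
    μ.real {ω | τ < |∑ i, w i * ε i ω|} ≤ 2 * Real.exp (-τ ^ 2 / (2 * (σ ^ 2 * v))) := by
  have hv : 0 ≤ v := (Finset.sum_nonneg fun i _ => sq_nonneg (w i)).trans hw
  have h := hε.hasSubgaussianMGF_sum w (v := ⟨v, hv⟩) hw
  have h₁ := h.measure_ge_le hτ
  have h₂ := h.neg.measure_ge_le hτ
  calc μ.real {ω | τ < |∑ i, w i * ε i ω|}
      ≤ μ.real ({ω | τ ≤ ∑ i, w i * ε i ω} ∪ {ω | τ ≤ (-fun ω => ∑ i, w i * ε i ω) ω}) := by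
        refine measureReal_mono fun ω hω => ?_
        rcases lt_abs.1 (show τ < |∑ i, w i * ε i ω| from hω) with h | h
        · exact Or.inl h.le
        · exact Or.inr h.le
    _ ≤ _ := measureReal_union_le _ _
    _ ≤ _ := by rw [two_mul]; exact add_le_add h₁ h₂

/-- Tail bound for a weighted sum of the noise whose random weights are independent of it. -/
theorem IsSubGaussianNoise.measureReal_lt_abs_sum_le_of_indepFun [IsProbabilityMeasure μ]
    {ε : Fin n → Ω → ℝ} {σ : ℝ} (hε : IsSubGaussianNoise μ ε σ) {W : Ω → Fin n → ℝ}
    (hW : Measurable W) (hind : IndepFun W (fun ω i => ε i ω) μ) {v τ : ℝ}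
    (hWv : ∀ᵐ ω ∂μ, ∑ i, W ω i ^ 2 ≤ v) (hτ : 0 ≤ τ) :
    μ.real {ω | τ < |∑ i, W ω i * ε i ω|} ≤ 2 * Real.exp (-τ ^ 2 / (2 * (σ ^ 2 * v))) := by
  have hεm : Measurable fun ω i => ε i ω := measurable_pi_lambda _ hε.measurable
  have hmap := (indepFun_iff_map_prod_eq_prod_map_map hW.aemeasurable hεm.aemeasurable).1 hind
  have hs : MeasurableSet {p : (Fin n → ℝ) × (Fin n → ℝ) | τ < |∑ i, p.1 i * p.2 i|} :=
    measurableSet_lt measurable_const (by fun_prop)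
  have hv : MeasurableSet {w : Fin n → ℝ | ∑ i, w i ^ 2 ≤ v} :=
    measurableSet_le (by fun_prop) measurable_const
  have := Measure.isProbabilityMeasure_map (μ := μ) hW.aemeasurable
  have := Measure.isProbabilityMeasure_map (μ := μ) hεm.aemeasurable
  have key : μ {ω | τ < |∑ i, W ω i * ε i ω|} ≤
      ENNReal.ofReal (2 * Real.exp (-τ ^ 2 / (2 * (σ ^ 2 * v)))) := by
    calc μ {ω | τ < |∑ i, W ω i * ε i ω|}
        = (μ.map fun ω => (W ω, fun i => ε i ω)) {p | τ < |∑ i, p.1 i * p.2 i|} :=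
          (Measure.map_apply (hW.prodMk hεm) hs).symm
      _ = ∫⁻ w, (μ.map fun ω i => ε i ω) {e | τ < |∑ i, w i * e i|} ∂(μ.map W) := by
          -- By independence the joint law is a product, so the weights can be frozen and the
          -- fixed-weight bound applied to each slice.
          rw [hmap, Measure.prod_apply hs]; rfl
      _ ≤ ∫⁻ _, ENNReal.ofReal (2 * Real.exp (-τ ^ 2 / (2 * (σ ^ 2 * v)))) ∂(μ.map W) := by
          refine lintegral_mono_ae ?_
          filter_upwards [(ae_map_iff hW.aemeasurable hv).2 hWv] with w hw
          rw [Measure.map_apply hεm (measurableSet_lt measurable_const (by fun_prop))]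
          refine (ENNReal.le_ofReal_iff_toReal_le (measure_ne_top _ _) (by positivity)).2 ?_
          exact hε.measureReal_lt_abs_sum_le w hw hτ
      _ = _ := by simp
  exact ENNReal.toReal_le_of_le_ofReal (by positivity) key

/-- A union bound over `m` sub-Gaussian tails at level `√(2 log m / n) + ζ`. -/
theorem card_mul_exp_le (m : ℕ) {n : ℕ} (hn : 0 < n) {ζ : ℝ} (hζ : 0 ≤ ζ) :
    m * (2 * Real.exp (-(n * (√(2 * Real.log m / n) + ζ) ^ 2 / 2))) ≤
      2 * Real.exp (-(n * ζ ^ 2 / 2)) := by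
  rcases Nat.eq_zero_or_pos m with rfl | hm
  · simp; positivity
  have hn' : (0 : ℝ) < n := Nat.cast_pos.2 hn
  have hm' : (0 : ℝ) < m := Nat.cast_pos.2 hm
  have hlog : 0 ≤ Real.log m := Real.log_natCast_nonneg m
  have hsq : √(2 * Real.log m / n) ^ 2 = 2 * Real.log m / n := Real.sq_sqrt (by positivity)
  -- Dropping the nonnegative cross term of the square leaves exactly the `log m` that cancels the
  -- factor `m`.
  have hle : Real.log m + n * ζ ^ 2 / 2 ≤ n * (√(2 * Real.log m / n) + ζ) ^ 2 / 2 := by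
    have h1 : (n : ℝ) * (√(2 * Real.log m / n) + ζ) ^ 2 / 2 =
        n * (2 * Real.log m / n) / 2 + n * (√(2 * Real.log m / n) * ζ) + n * ζ ^ 2 / 2 := by
      linear_combination (n : ℝ) / 2 * hsq
    have h2 : n * (2 * Real.log m / n) / 2 = Real.log m := by field_simp
    rw [h1, h2]
    have : 0 ≤ n * (√(2 * Real.log m / n) * ζ) := by positivity
    linarith
  calc m * (2 * Real.exp (-(n * (√(2 * Real.log m / n) + ζ) ^ 2 / 2)))
      ≤ m * (2 * Real.exp (-(Real.log m + n * ζ ^ 2 / 2))) := by gcongr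
    _ = _ := by rw [neg_add, Real.exp_add, Real.exp_neg, Real.exp_log hm']; field_simp

/-- Union bound for finitely many weighted sums of the noise with random weights. -/
theorem IsSubGaussianNoise.measureReal_iUnion_le [IsProbabilityMeasure μ] {ι : Type*}
    [Fintype ι] {ε : Fin n → Ω → ℝ} {σ : ℝ} (hσ : 0 < σ) (hε : IsSubGaussianNoise μ ε σ)
    (hn : 0 < n) {W : ι → Ω → Fin n → ℝ} (hW : ∀ k, Measurable (W k))
    (hind : ∀ k, IndepFun (W k) (fun ω i => ε i ω) μ) {b τ ζ : ℝ} (hb : 0 < b)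
    (hWv : ∀ k, ∀ᵐ ω ∂μ, ∑ i, W k ω i ^ 2 ≤ b ^ 2 / n) (hζ : 0 ≤ ζ)
    (hτ : τ = σ * b * (√(2 * Real.log (Fintype.card ι) / n) + ζ)) :
    μ.real (⋃ k, {ω | τ < |∑ i, W k ω i * ε i ω|}) ≤ 2 * Real.exp (-(n * ζ ^ 2 / 2)) := by
  have hn' : (0 : ℝ) < n := Nat.cast_pos.2 hn
  have hexp : -τ ^ 2 / (2 * (σ ^ 2 * (b ^ 2 / n))) =
      -(n * (√(2 * Real.log (Fintype.card ι) / n) + ζ) ^ 2 / 2) := by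
    rw [hτ]; field_simp
  calc μ.real (⋃ k, {ω | τ < |∑ i, W k ω i * ε i ω|})
      ≤ ∑ k, μ.real {ω | τ < |∑ i, W k ω i * ε i ω|} := measureReal_iUnion_fintype_le _
    _ ≤ ∑ _k : ι, 2 * Real.exp (-(n * (√(2 * Real.log (Fintype.card ι) / n) + ζ) ^ 2 / 2)) := by
        refine Finset.sum_le_sum fun k _ => ?_
        rw [← hexp]
        exact hε.measureReal_lt_abs_sum_le_of_indepFun (hW k) (hind k) (hWv k)
          (by rw [hτ]; positivity)
    _ ≤ _ := by
        rw [Finset.sum_const, nsmul_eq_mul, Finset.card_univ]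
        exact card_mul_exp_le _ hn hζ

end Noise

/-- The least squares operator `(X_Sᵀ X_S)⁻¹ X_Sᵀ` of the columns with index in `S`. -/
noncomputable def leastSquares {n d : ℕ} (X : Matrix (Fin n) (Fin d) ℝ) (S : Finset (Fin d)) :
    Matrix S (Fin n) ℝ :=
  ((colsOn X S)ᵀ * colsOn X S)⁻¹ * (colsOn X S)ᵀ

/-- The residual of the `j`-th column after projection onto the span of the columns in `S`. -/
noncomputable def residual {n d : ℕ} (X : Matrix (Fin n) (Fin d) ℝ) (S : Finset (Fin d))
    (j : Fin d) : Fin n → ℝ :=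
  (fun i => X i j) - colsOn X S *ᵥ (leastSquares X S *ᵥ fun i => X i j)

/-- The vector `(1/n) Xᵀ (y - X θ)`, minus the gradient of the quadratic loss at `θ`. -/
noncomputable def score {n d : ℕ} (X : Matrix (Fin n) (Fin d) ℝ) (y : Fin n → ℝ) (θ : Fin d → ℝ) :
    Fin d → ℝ :=
  (1 / (n : ℝ)) • (Xᵀ *ᵥ (y - X *ᵥ θ))

/-! ### Least squares and projection on the columns in `S` -/

section Design

variable {n d : ℕ} {X : Matrix (Fin n) (Fin d) ℝ} {S : Finset (Fin d)}

theorem sum_eq_sum_subtype_of_zero_off {f : Fin d → ℝ} (hf : ∀ j, j ∉ S → f j = 0) :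
    ∑ j, f j = ∑ k : S, f k := by
  rw [Finset.sum_coe_sort S f]
  exact (Finset.sum_subset (Finset.subset_univ S) fun j _ hj => hf j hj).symm

theorem mulVec_eq_colsOn_mulVec {θ : Fin d → ℝ} (hθ : ∀ j, j ∉ S → θ j = 0) :
    X *ᵥ θ = colsOn X S *ᵥ fun k : S => θ k := by
  ext i
  exact sum_eq_sum_subtype_of_zero_off fun j hj => by rw [hθ j hj, mul_zero]

/-- Subtracting `c` times the identity shifts the spectrum by `c`, so the difference is positive
semidefinite. -/
theorem quadratic_form_ge_of_eigenvalues_ge {ι : Type*} [Fintype ι] [DecidableEq ι]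
    {A : Matrix ι ι ℝ} (hA : A.IsHermitian) {c : ℝ} (h : ∀ i, c ≤ hA.eigenvalues i)
    (u : ι → ℝ) : c * (u ⬝ᵥ u) ≤ u ⬝ᵥ (A *ᵥ u) := by
  have hpsd : (A - algebraMap ℝ (Matrix ι ι ℝ) c).PosSemidef := by
    rw [Matrix.posSemidef_iff_isHermitian_and_spectrum_nonneg]
    refine ⟨hA.sub ?_, fun x hx => ?_⟩
    · rw [Matrix.algebraMap_eq_diagonal]
      exact Matrix.isHermitian_diagonal _
    · rw [← spectrum.sub_singleton_eq, hA.spectrum_real_eq_range_eigenvalues] at hx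
      obtain ⟨_, ⟨i, rfl⟩, _, rfl, rfl⟩ := hx
      exact sub_nonneg.2 (h i)
  have := hpsd.dotProduct_mulVec_nonneg u
  rw [Matrix.sub_mulVec, dotProduct_sub, Algebra.algebraMap_eq_smul_one, Matrix.smul_mulVec,
    Matrix.one_mulVec, dotProduct_smul, star_trivial, smul_eq_mul] at this
  linarith

/-- The lower eigenvalue condition as a bound on `‖X_S u‖₂²`. -/
theorem LowerEigenvalue.le_dotProduct (hn : 0 < n) {cmin : ℝ} (h : LowerEigenvalue X S cmin)
    (u : S → ℝ) :
    n * cmin * (u ⬝ᵥ u) ≤ (colsOn X S *ᵥ u) ⬝ᵥ (colsOn X S *ᵥ u) := by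
  have h1 := quadratic_form_ge_of_eigenvalues_ge (gramOn_isHermitian X S) h u
  have hn' : (0 : ℝ) < n := Nat.cast_pos.2 hn
  have h2 : u ⬝ᵥ (gramOn X S *ᵥ u) =
      1 / n * ((colsOn X S *ᵥ u) ⬝ᵥ (colsOn X S *ᵥ u)) := by
    rw [gramOn, Matrix.smul_mulVec, dotProduct_smul, ← Matrix.mulVec_mulVec,
      Matrix.dotProduct_mulVec, Matrix.vecMul_transpose, smul_eq_mul]
  rw [h2, one_div, inv_mul_eq_div, le_div_iff₀ hn'] at h1
  linarith

theorem eq_zero_of_colsOn_mulVec_eq_zero (hn : 0 < n) {cmin : ℝ} (hc : 0 < cmin)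
    (h : LowerEigenvalue X S cmin) {u : S → ℝ} (hu : colsOn X S *ᵥ u = 0) : u = 0 := by
  have h1 := h.le_dotProduct hn u
  rw [hu, dotProduct_zero] at h1
  have hpos : 0 < n * cmin := mul_pos (Nat.cast_pos.2 hn) hc
  refine dotProduct_self_eq_zero.1 (le_antisymm ?_ ?_)
  · exact nonpos_of_mul_nonpos_right h1 hpos
  · exact Finset.sum_nonneg fun i _ => mul_self_nonneg _

theorem isUnit_det_of_lowerEigenvalue (hn : 0 < n) {cmin : ℝ} (hc : 0 < cmin)
    (h : LowerEigenvalue X S cmin) : IsUnit ((colsOn X S)ᵀ * colsOn X S).det := by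
  rw [isUnit_iff_ne_zero]
  intro hdet
  obtain ⟨u, hu, hu0⟩ := Matrix.exists_mulVec_eq_zero_iff.2 hdet
  refine hu (eq_zero_of_colsOn_mulVec_eq_zero hn hc h (dotProduct_self_eq_zero.1 ?_))
  nth_rewrite 1 [← Matrix.vecMul_transpose]
  rw [← Matrix.dotProduct_mulVec, Matrix.mulVec_mulVec, hu0, dotProduct_zero]

theorem leastSquares_mulVec_colsOn (h : IsUnit ((colsOn X S)ᵀ * colsOn X S).det) (u : S → ℝ) :
    leastSquares X S *ᵥ (colsOn X S *ᵥ u) = u := by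
  rw [leastSquares, Matrix.mulVec_mulVec, Matrix.mul_assoc, Matrix.nonsing_inv_mul _ h,
    Matrix.one_mulVec]

theorem transpose_mulVec_colsOn_leastSquares (h : IsUnit ((colsOn X S)ᵀ * colsOn X S).det)
    (v : Fin n → ℝ) :
    (colsOn X S)ᵀ *ᵥ (colsOn X S *ᵥ (leastSquares X S *ᵥ v)) = (colsOn X S)ᵀ *ᵥ v := by
  rw [leastSquares, ← Matrix.mulVec_mulVec, Matrix.mulVec_mulVec, Matrix.mulVec_mulVec,
    Matrix.mul_nonsing_inv _ h, Matrix.one_mulVec]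

theorem transpose_mulVec_residual (h : IsUnit ((colsOn X S)ᵀ * colsOn X S).det) (j : Fin d) :
    (colsOn X S)ᵀ *ᵥ residual X S j = 0 := by
  rw [residual, Matrix.mulVec_sub, transpose_mulVec_colsOn_leastSquares h, sub_self]

theorem residual_dotProduct_colsOn (h : IsUnit ((colsOn X S)ᵀ * colsOn X S).det) (j : Fin d)
    (u : S → ℝ) : residual X S j ⬝ᵥ (colsOn X S *ᵥ u) = 0 := by
  rw [Matrix.dotProduct_mulVec, ← Matrix.mulVec_transpose, transpose_mulVec_residual h,
    zero_dotProduct]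

/-- Separates the part of a correlation controlled by the noise from the part controlled by
incoherence. -/
theorem col_dotProduct (j : Fin d) (v : Fin n → ℝ) :
    (fun i => X i j) ⬝ᵥ v = residual X S j ⬝ᵥ v +
      (leastSquares X S *ᵥ fun i => X i j) ⬝ᵥ ((colsOn X S)ᵀ *ᵥ v) := by
  rw [Matrix.dotProduct_mulVec, Matrix.vecMul_transpose, residual, sub_dotProduct,
    sub_add_cancel]

/-- Projecting a column shrinks its norm. -/
theorem residual_sq_le (h : IsUnit ((colsOn X S)ᵀ * colsOn X S).det) (j : Fin d) :
    ∑ i, residual X S j i ^ 2 ≤ ∑ i, X i j ^ 2 := by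
  set p := colsOn X S *ᵥ (leastSquares X S *ᵥ fun i => X i j) with hp
  have hx : ∀ i, X i j = residual X S j i + p i := fun i => by
    simp [residual, hp]
  have h0 : ∑ i, residual X S j i * p i = 0 := residual_dotProduct_colsOn h j _
  calc ∑ i, residual X S j i ^ 2
      ≤ ∑ i, residual X S j i ^ 2 + 2 * ∑ i, residual X S j i * p i + ∑ i, p i ^ 2 := by
        rw [h0]
        have : 0 ≤ ∑ i, p i ^ 2 := Finset.sum_nonneg fun i _ => sq_nonneg _
        linarith
    _ = ∑ i, X i j ^ 2 := by
        rw [Finset.mul_sum, ← Finset.sum_add_distrib, ← Finset.sum_add_distrib]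
        exact Finset.sum_congr rfl fun i _ => by rw [hx i]; ring

theorem residual_sq_le_of_columnNormalized (hn : 0 < n) {C : ℝ} (hC : ColumnNormalized X C)
    (h : IsUnit ((colsOn X S)ᵀ * colsOn X S).det) (j : Fin d) :
    ∑ i, residual X S j i ^ 2 ≤ C ^ 2 * n := by
  have hn' : (0 : ℝ) < n := Nat.cast_pos.2 hn
  have h1 := hC j
  rw [← Real.sqrt_div' _ hn'.le] at h1
  have h2 := Real.sqrt_le_iff.1 h1
  exact (residual_sq_le h j).trans ((div_le_iff₀ hn').1 h2.2)

/-- With `G = X_Sᵀ X_S` and `q = G⁻¹ e_k`, row `k` is `X_S q` and its squared norm is `qᵀ G q =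
q_k`. The eigenvalue bound gives `n cmin q_k² ≤ q_k`, hence `q_k ≤ 1 / (n cmin)`. -/
theorem leastSquares_row_sq_le (hn : 0 < n) {cmin : ℝ} (hc : 0 < cmin)
    (h : LowerEigenvalue X S cmin) (k : S) :
    ∑ i, leastSquares X S k i ^ 2 ≤ 1 / (n * cmin) := by
  have hu := isUnit_det_of_lowerEigenvalue hn hc h
  have hpos : 0 < n * cmin := mul_pos (Nat.cast_pos.2 hn) hc
  set G := (colsOn X S)ᵀ * colsOn X S with hG
  have hGt : Gᵀ = G := by rw [hG, Matrix.transpose_mul, Matrix.transpose_transpose]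
  set q : S → ℝ := G⁻¹ *ᵥ Pi.single k 1 with hq
  have hrow : ∀ i, leastSquares X S k i = (colsOn X S *ᵥ q) i := fun i => by
    have hinv : ∀ l, G⁻¹ k l = q l := fun l => by
      rw [hq, Matrix.mulVec_single_one]
      change G⁻¹ k l = (G⁻¹)ᵀ k l
      rw [Matrix.transpose_nonsing_inv, hGt]
    rw [leastSquares, ← hG, Matrix.mul_apply, Matrix.mulVec, dotProduct]
    exact Finset.sum_congr rfl fun l _ => by rw [hinv l, Matrix.transpose_apply, mul_comm]
  have hsum : ∑ i, leastSquares X S k i ^ 2 = (colsOn X S *ᵥ q) ⬝ᵥ (colsOn X S *ᵥ q) :=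
    Finset.sum_congr rfl fun i _ => by rw [hrow i, sq]
  have hqk : (colsOn X S *ᵥ q) ⬝ᵥ (colsOn X S *ᵥ q) = q k := by
    nth_rewrite 1 [← Matrix.vecMul_transpose]
    rw [← Matrix.dotProduct_mulVec, Matrix.mulVec_mulVec, ← hG, hq, Matrix.mulVec_mulVec,
      Matrix.mul_nonsing_inv _ hu, Matrix.one_mulVec, dotProduct_single_one]
  have hle := h.le_dotProduct hn q
  have hkk : q k ^ 2 ≤ q ⬝ᵥ q := by
    rw [sq]
    exact Finset.single_le_sum (f := fun l => q l * q l) (fun l _ => mul_self_nonneg _)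
      (Finset.mem_univ k)
  rw [hqk] at hle hsum
  rw [hsum, le_div_iff₀ hpos]
  have h3 : n * cmin * q k ^ 2 ≤ q k := (mul_le_mul_of_nonneg_left hkk hpos.le).trans hle
  rcases le_or_gt (q k) 0 with h4 | h4
  · nlinarith
  · nlinarith

/-! ### Optimality conditions -/

/-- The loss is quadratic, so its second-order Taylor expansion at `θ` is exact. -/
theorem objective_eq (hn : 0 < n) (y : Fin n → ℝ) (lam : ℝ) (θ θ' : Fin d → ℝ) :
    objective X y lam θ' = objective X y lam θ +
      1 / (2 * (n : ℝ)) * ∑ i, (X *ᵥ (θ' - θ)) i ^ 2 -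
      ∑ j, score X y θ j * (θ' j - θ j) + lam * (∑ j, |θ' j| - ∑ j, |θ j|) := by
  have hn' : (n : ℝ) ≠ 0 := (Nat.cast_pos.2 hn).ne'
  have h1 : ∑ j, score X y θ j * (θ' j - θ j) =
      1 / (n : ℝ) * ∑ i, (y i - (X *ᵥ θ) i) * (X *ᵥ (θ' - θ)) i := by
    change score X y θ ⬝ᵥ (θ' - θ) = 1 / (n : ℝ) * ((y - X *ᵥ θ) ⬝ᵥ (X *ᵥ (θ' - θ)))
    rw [score, smul_dotProduct, Matrix.dotProduct_mulVec, Matrix.mulVec_transpose, smul_eq_mul]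
  have h2 : ∑ i, (y i - (X *ᵥ θ') i) ^ 2 = ∑ i, (y i - (X *ᵥ θ) i) ^ 2 +
      ∑ i, (X *ᵥ (θ' - θ)) i ^ 2 - 2 * ∑ i, (y i - (X *ᵥ θ) i) * (X *ᵥ (θ' - θ)) i := by
    rw [Finset.mul_sum, ← Finset.sum_add_distrib, ← Finset.sum_sub_distrib]
    refine Finset.sum_congr rfl fun i _ => ?_
    rw [Matrix.mulVec_sub, Pi.sub_apply]
    ring
  rw [h1, objective, objective, h2]
  field_simp
  ring

/-- A point satisfying the optimality conditions, strictly outside `S`, is the unique solution. -/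
theorem isSolution_and_unique (hn : 0 < n) {cmin : ℝ} (hc : 0 < cmin)
    (h : LowerEigenvalue X S cmin) {y : Fin n → ℝ} {lam : ℝ} {θ : Fin d → ℝ}
    (hoff : ∀ j, j ∉ S → θ j = 0) (hle : ∀ j, |score X y θ j| ≤ lam)
    (heq : ∀ j, score X y θ j * θ j = lam * |θ j|) (hlt : ∀ j, j ∉ S → |score X y θ j| < lam) :
    IsSolution X y lam θ ∧ ∀ θ', IsSolution X y lam θ' → θ' = θ := by
  have hn' : (0 : ℝ) < n := Nat.cast_pos.2 hn
  have hterm : ∀ (θ' : Fin d → ℝ) j, 0 ≤ lam * |θ' j| - score X y θ j * θ' j := fun θ' j => by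
    rw [sub_nonneg]
    refine (le_abs_self _).trans ?_
    rw [abs_mul]
    exact mul_le_mul_of_nonneg_right (hle j) (abs_nonneg _)
  -- By `heq` the linear and `ℓ₁` terms at `θ` cancel, so the excess objective is a sum of a
  -- quadratic term and coordinatewise slacks, all nonnegative.
  have hdiff : ∀ θ', objective X y lam θ' = objective X y lam θ +
      1 / (2 * (n : ℝ)) * ∑ i, (X *ᵥ (θ' - θ)) i ^ 2 +
      ∑ j, (lam * |θ' j| - score X y θ j * θ' j) := fun θ' => by
    rw [objective_eq hn y lam θ θ']
    simp only [mul_sub, Finset.sum_sub_distrib, heq, Finset.mul_sum]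
    ring
  have hquad : ∀ θ' : Fin d → ℝ, 0 ≤ ∑ i, (X *ᵥ (θ' - θ)) i ^ 2 := fun θ' =>
    Finset.sum_nonneg fun i _ => sq_nonneg _
  have hsum : ∀ θ' : Fin d → ℝ, 0 ≤ ∑ j, (lam * |θ' j| - score X y θ j * θ' j) := fun θ' =>
    Finset.sum_nonneg fun j _ => hterm θ' j
  refine ⟨fun θ' => ?_, fun θ' hθ' => ?_⟩
  · rw [hdiff θ']
    have := mul_nonneg (by positivity : 0 ≤ 1 / (2 * (n : ℝ))) (hquad θ')
    linarith [hsum θ']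
  · have h1 := hθ' θ
    rw [hdiff θ'] at h1
    have h2 := mul_nonneg (by positivity : 0 ≤ 1 / (2 * (n : ℝ))) (hquad θ')
    have h3 : ∑ j, (lam * |θ' j| - score X y θ j * θ' j) = 0 :=
      le_antisymm (by linarith) (hsum θ')
    have h4 : ∑ i, (X *ᵥ (θ' - θ)) i ^ 2 = 0 := by
      have : 1 / (2 * (n : ℝ)) * ∑ i, (X *ᵥ (θ' - θ)) i ^ 2 = 0 := by linarith
      exact (mul_eq_zero.1 this).resolve_left (by positivity)
    -- A second minimizer has zero slack in every coordinate; off `S` the strict bound on the score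
    -- makes the slack positive unless `θ' j = 0`.
    have hoff' : ∀ j, j ∉ S → θ' j = 0 := fun j hj => by
      have h5 := (Finset.sum_eq_zero_iff_of_nonneg fun j _ => hterm θ' j).1 h3 j
        (Finset.mem_univ j)
      by_contra hne
      have h6 : score X y θ j * θ' j ≤ |score X y θ j| * |θ' j| := by
        rw [← abs_mul]; exact le_abs_self _
      have h7 := mul_lt_mul_of_pos_right (hlt j hj) (abs_pos.2 hne)
      linarith
    have h8 : X *ᵥ (θ' - θ) = 0 := funext fun i => by
      have := (Finset.sum_eq_zero_iff_of_nonneg fun i _ => sq_nonneg _).1 h4 i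
        (Finset.mem_univ i)
      exact pow_eq_zero_iff two_ne_zero |>.1 this
    rw [mulVec_eq_colsOn_mulVec (S := S) fun j hj => by
      rw [Pi.sub_apply, hoff' j hj, hoff j hj, sub_zero]] at h8
    have h9 := eq_zero_of_colsOn_mulVec_eq_zero hn hc h h8
    ext j
    by_cases hj : j ∈ S
    · exact sub_eq_zero.1 (congrFun h9 ⟨j, hj⟩)
    · rw [hoff' j hj, hoff j hj]

/-- The penalty alone makes the objective coercive, and vectors supported in `S` form a closed set.
-/
theorem exists_restricted_minimizer (S : Finset (Fin d)) (X : Matrix (Fin n) (Fin d) ℝ)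
    (y : Fin n → ℝ) {lam : ℝ} (hlam : 0 < lam) :
    ∃ θ : Fin d → ℝ, (∀ j, j ∉ S → θ j = 0) ∧
      ∀ θ' : Fin d → ℝ, (∀ j, j ∉ S → θ' j = 0) →
        objective X y lam θ ≤ objective X y lam θ' := by
  have hcont : Continuous (objective X y lam) := by
    unfold objective Matrix.mulVec dotProduct
    fun_prop
  have hclosed : IsClosed {θ : Fin d → ℝ | ∀ j, j ∉ S → θ j = 0} := by
    simp only [Set.ofPred_forall]
    exact isClosed_iInter fun j => isClosed_iInter fun _ =>
      isClosed_eq (continuous_apply j) continuous_const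
  have hge : ∀ θ, lam * ‖θ‖ ≤ objective X y lam θ := fun θ => by
    have h1 : ‖θ‖ ≤ ∑ j, |θ j| := by
      refine (pi_norm_le_iff_of_nonneg (Finset.sum_nonneg fun j _ => abs_nonneg _)).2 fun j => ?_
      exact Finset.single_le_sum (f := fun j => |θ j|) (fun j _ => abs_nonneg _)
        (Finset.mem_univ j)
    have h2 : 0 ≤ 1 / (2 * (n : ℝ)) * ∑ i, (y i - (X *ᵥ θ) i) ^ 2 :=
      mul_nonneg (by positivity) (Finset.sum_nonneg fun i _ => sq_nonneg _)
    have h3 := mul_le_mul_of_nonneg_left h1 hlam.le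
    unfold objective
    linarith
  have hcoer : ∀ᶠ θ in Filter.cocompact (Fin d → ℝ),
      objective X y lam 0 ≤ objective X y lam θ := by
    have := (tendsto_norm_cocompact_atTop (E := Fin d → ℝ)).const_mul_atTop hlam
    filter_upwards [this.eventually_ge_atTop (objective X y lam 0)] with θ hθ
    exact hθ.trans (hge θ)
  obtain ⟨θ, hθ, hmin⟩ := hcont.continuousOn.exists_isMinOn' hclosed
    (x₀ := 0) (fun _ _ => rfl) (hcoer.filter_mono inf_le_left)
  exact ⟨θ, hθ, fun θ' hθ' => hmin hθ'⟩

/-- Replaces letting `s → 0` in the first-order arguments below, where `c * s` is what the quadratic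
term leaves after division by `s`. -/
theorem le_of_forall_le_mul_add {a b c : ℝ} (hc : 0 ≤ c)
    (h : ∀ s, 0 < s → s ≤ 1 → a ≤ c * s + b) : a ≤ b := by
  by_contra! hab
  set s := min 1 ((a - b) / 2 / (c + 1)) with hs
  have hs0 : 0 < s := lt_min one_pos (by have := sub_pos.2 hab; positivity)
  have h1 := h s hs0 (min_le_left _ _)
  have h2 : s * (c + 1) ≤ (a - b) / 2 := (le_div_iff₀ (by positivity)).1 (min_le_right _ _)
  nlinarith

/-- Optimality conditions for the Lasso restricted to vectors supported in `S`. -/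
theorem score_of_restricted_minimizer (hn : 0 < n) {y : Fin n → ℝ} {lam : ℝ}
    (hlam : 0 ≤ lam) {θ : Fin d → ℝ} (hoff : ∀ j, j ∉ S → θ j = 0)
    (hmin : ∀ θ' : Fin d → ℝ, (∀ j, j ∉ S → θ' j = 0) →
      objective X y lam θ ≤ objective X y lam θ') {k : Fin d} (hk : k ∈ S) :
    |score X y θ k| ≤ lam ∧ score X y θ k * θ k = lam * |θ k| := by
  set g := score X y θ k with hg
  set c := 1 / (2 * (n : ℝ)) * ∑ i, X i k ^ 2 with hc
  have hc0 : 0 ≤ c := mul_nonneg (by positivity) (Finset.sum_nonneg fun i _ => sq_nonneg _)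
  have key : ∀ t : ℝ, 0 ≤ c * t ^ 2 - g * t + lam * (|θ k + t| - |θ k|) := fun t => by
    have h1 := hmin (θ + (Pi.single k t : Fin d → ℝ)) fun j hj => by
      rw [Pi.add_apply, hoff j hj, Pi.single_eq_of_ne (ne_of_mem_of_not_mem hk hj).symm, add_zero]
    rw [objective_eq hn y lam θ (θ + (Pi.single k t : Fin d → ℝ)), add_sub_cancel_left] at h1
    have h2 : ∑ i, (X *ᵥ Pi.single k t) i ^ 2 = (∑ i, X i k ^ 2) * t ^ 2 := by
      simp [Matrix.mulVec_single, mul_pow, Finset.sum_mul]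
    have h3 : ∑ j, score X y θ j * ((θ + (Pi.single k t : Fin d → ℝ)) j - θ j) = g * t := by
      rw [Finset.sum_eq_single k]
      · simp [hg]
      · intro j _ hj
        simp [hj]
      · simp
    have h4 : ∑ j, |(θ + (Pi.single k t : Fin d → ℝ)) j| - ∑ j, |θ j| = |θ k + t| - |θ k| := by
      rw [← Finset.sum_sub_distrib, Finset.sum_eq_single k]
      · simp
      · intro j _ hj
        simp [hj]
      · simp
    rw [h2, h3, h4] at h1
    rw [hc]
    linarith
  have hbound : |g| ≤ lam := by
    have htri : ∀ t, lam * (|θ k + t| - |θ k|) ≤ lam * |t| := fun t =>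
      mul_le_mul_of_nonneg_left (by linarith [abs_add_le (θ k) t]) hlam
    refine abs_le'.2 ⟨le_of_forall_le_mul_add hc0 fun s hs _ => ?_,
      le_of_forall_le_mul_add hc0 fun s hs _ => ?_⟩
    · have h1 := (key s).trans (add_le_add_right (htri s) _)
      rw [abs_of_pos hs] at h1
      refine le_of_mul_le_mul_right ?_ hs
      linarith
    · have h1 := (key (-s)).trans (add_le_add_right (htri (-s)) _)
      rw [abs_neg, abs_of_pos hs] at h1
      refine le_of_mul_le_mul_right ?_ hs
      linarith
  refine ⟨hbound, le_antisymm ?_ ?_⟩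
  · refine (le_abs_self _).trans ?_
    rw [abs_mul]
    exact mul_le_mul_of_nonneg_right hbound (abs_nonneg _)
  · refine le_of_forall_le_mul_add (c := c * θ k ^ 2) (by positivity) fun s hs hs1 => ?_
    -- Shrinking the coordinate towards zero; `s ≤ 1` keeps its sign, so the penalty drops by
    -- exactly `lam * s * |θ k|`.
    have h1 := key (-s * θ k)
    have h2 : |θ k + -s * θ k| = (1 - s) * |θ k| := by
      rw [show θ k + -s * θ k = (1 - s) * θ k by ring, abs_mul, abs_of_nonneg (by linarith)]
    rw [h2] at h1
    refine le_of_mul_le_mul_right ?_ hs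
    nlinarith

/-! ### Deterministic support recovery and error bound -/

theorem MutualIncoherence.abs_dotProduct_le {α₁ M : ℝ} (h : MutualIncoherence X S α₁)
    (hM : 0 ≤ M) {v : S → ℝ} (hv : ∀ k, |v k| ≤ M) {j : Fin d} (hj : j ∉ S) :
    |(leastSquares X S *ᵥ fun i => X i j) ⬝ᵥ v| ≤ α₁ * M := by
  calc |(leastSquares X S *ᵥ fun i => X i j) ⬝ᵥ v|
      ≤ ∑ k, |(leastSquares X S *ᵥ fun i => X i j) k * v k| := Finset.abs_sum_le_sum_abs _ _
    _ ≤ ∑ k, |(leastSquares X S *ᵥ fun i => X i j) k| * M := by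
        refine Finset.sum_le_sum fun k _ => ?_
        rw [abs_mul]
        exact mul_le_mul_of_nonneg_left (hv k) (abs_nonneg _)
    _ ≤ α₁ * M := by
        rw [← Finset.sum_mul]
        exact mul_le_mul_of_nonneg_right (h j hj) hM

/-- The `ℓ_∞`-curvature condition bounds `(X_Sᵀ X_S)⁻¹ X_Sᵀ v` by the correlations of `v` with
the columns in `S`. -/
theorem SupCurvature.abs_leastSquares_le {a α₁ α₂ lam : ℝ} (hn : 0 < n) (ha : 0 ≤ a)
    (hα₁ : α₁ < 1) (hα₂ : 0 < α₂) (hlam : 0 ≤ lam)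
    (hu : IsUnit ((colsOn X S)ᵀ * colsOn X S).det) (hinc : MutualIncoherence X S α₁)
    (hcurv : SupCurvature X S a α₂) {v : Fin n → ℝ}
    (hv : ∀ k, |((colsOn X S)ᵀ *ᵥ v) k| ≤ n * lam) (k : S) :
    |(leastSquares X S *ᵥ v) k| ≤ 1 / α₂ * lam := by
  have hn' : (0 : ℝ) < n := Nat.cast_pos.2 hn
  have hnl : 0 ≤ n * lam := mul_nonneg hn'.le hlam
  set u := leastSquares X S *ᵥ v with hudef
  -- The extension of `u` by zero lies in the cone for every `a ≥ 0`, and `gram X *ᵥ z` collects the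
  -- correlations, divided by `n`, of all columns with the projection of `v`.
  set z : Fin d → ℝ := fun j => if hj : j ∈ S then u ⟨j, hj⟩ else 0 with hz
  have hzoff : ∀ j, j ∉ S → z j = 0 := fun j hj => dif_neg hj
  have hzon : (fun k : S => z k) = u := funext fun k => dif_pos k.2
  have hcone : z ∈ cone a S := by
    change ∑ j ∈ Sᶜ, |z j| ≤ a * ∑ j ∈ S, |z j|
    rw [Finset.sum_eq_zero fun j hj => by rw [hzoff j (Finset.mem_compl.1 hj), abs_zero]]
    exact mul_nonneg ha (Finset.sum_nonneg fun j _ => abs_nonneg _)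
  have hgram : ∀ j, (gram X *ᵥ z) j =
      1 / n * ((fun i => X i j) ⬝ᵥ (colsOn X S *ᵥ u)) := fun j => by
    rw [gram, Matrix.smul_mulVec, ← Matrix.mulVec_mulVec, mulVec_eq_colsOn_mulVec hzoff, hzon]
    rfl
  have hcorr : ∀ j, |(fun i => X i j) ⬝ᵥ (colsOn X S *ᵥ u)| ≤ n * lam := fun j => by
    by_cases hj : j ∈ S
    · have h1 : (fun i => X i j) ⬝ᵥ (colsOn X S *ᵥ u) =
          ((colsOn X S)ᵀ *ᵥ (colsOn X S *ᵥ u)) ⟨j, hj⟩ := rfl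
      rw [h1, hudef, transpose_mulVec_colsOn_leastSquares hu]
      exact hv _
    -- Off `S` only the projection of `x_j` contributes, so incoherence with `α₁ < 1` carries the
    -- bound over from the columns in `S`.
    · rw [col_dotProduct (S := S), residual_dotProduct_colsOn hu, zero_add, hudef,
        transpose_mulVec_colsOn_leastSquares hu]
      exact (hinc.abs_dotProduct_le hnl hv hj).trans (mul_le_of_le_one_left hnl hα₁.le)
  have hnorm : ‖gram X *ᵥ z‖ ≤ lam := (pi_norm_le_iff_of_nonneg hlam).2 fun j => by
    rw [hgram, Real.norm_eq_abs, abs_mul, abs_of_pos (by positivity), one_div, inv_mul_le_iff₀ hn']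
    exact hcorr j
  have hk : |u k| ≤ ‖z‖ := by
    rw [← congrFun hzon k]
    exact norm_le_pi_norm z k
  rw [one_div, ← div_eq_inv_mul, le_div_iff₀ hα₂, mul_comm]
  exact (mul_le_mul_of_nonneg_left hk hα₂.le).trans ((hcurv z hcone).trans hnorm)

/-- Support recovery and the `ℓ_∞`-error bound on the event where the noise is under control. -/
theorem exists_unique_solution_of_noise_bounds {θstar : Fin d → ℝ} {e : Fin n → ℝ}
    {α₁ α₂ a cmin lam τ : ℝ} (hn : 0 < n) (hα₁ : α₁ < 1) (hα₂ : 0 < α₂) (ha : 0 ≤ a)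
    (hcmin : 0 < cmin) (hlam : 0 < lam) (hτ : 0 ≤ τ) (hoff : ∀ j, j ∉ S → θstar j = 0)
    (hinc : MutualIncoherence X S α₁) (heig : LowerEigenvalue X S cmin)
    (hcurv : SupCurvature X S a α₂)
    (hon_noise : ∀ k : S, |leastSquares X S k ⬝ᵥ e| ≤ τ)
    (hoff_noise : ∀ j, j ∉ S → |residual X S j ⬝ᵥ e| < n * (lam * (1 - α₁))) :
    ∃ θhat : Fin d → ℝ,
      IsSolution X (fun i => (X *ᵥ θstar) i + e i) lam θhat ∧
      (∀ θ, IsSolution X (fun i => (X *ᵥ θstar) i + e i) lam θ → θ = θhat) ∧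
      (∀ j, θhat j ≠ 0 → j ∈ S) ∧
      ‖fun j : S => θhat j - θstar j‖ ≤ τ + 1 / α₂ * lam := by
  have hn' : (0 : ℝ) < n := Nat.cast_pos.2 hn
  have hu := isUnit_det_of_lowerEigenvalue hn hcmin heig
  set y : Fin n → ℝ := fun i => (X *ᵥ θstar) i + e i with hy
  obtain ⟨θ, hθoff, hmin⟩ := exists_restricted_minimizer S X y hlam
  have hkkt := fun k (hk : k ∈ S) => score_of_restricted_minimizer hn hlam.le hθoff hmin hk
  set w : S → ℝ := fun k => θstar k - θ k with hw
  set r := y - X *ᵥ θ with hr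
  have hrw : r = colsOn X S *ᵥ w + e := by
    have h1 : r = X *ᵥ (θstar - θ) + e := by
      rw [hr, Matrix.mulVec_sub]
      ext i
      simp only [hy, Pi.sub_apply, Pi.add_apply]
      ring
    rw [h1, mulVec_eq_colsOn_mulVec (S := S) fun j hj => by
      rw [Pi.sub_apply, hoff j hj, hθoff j hj, sub_zero]]
    rfl
  have hscore : ∀ j, (fun i => X i j) ⬝ᵥ r = n * score X y θ j := fun j => by
    have : score X y θ j = 1 / n * ((fun i => X i j) ⬝ᵥ r) := rfl
    rw [this]
    field_simp
  have hon : ∀ k : S, |((colsOn X S)ᵀ *ᵥ r) k| ≤ n * lam := fun k => by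
    change |(fun i => X i k) ⬝ᵥ r| ≤ n * lam
    rw [hscore, abs_mul, abs_of_pos hn']
    exact mul_le_mul_of_nonneg_left (hkkt k k.2).1 hn'.le
  have hlt : ∀ j, j ∉ S → |score X y θ j| < lam := fun j hj => by
    have h1 : n * score X y θ j = residual X S j ⬝ᵥ e +
        (leastSquares X S *ᵥ fun i => X i j) ⬝ᵥ ((colsOn X S)ᵀ *ᵥ r) := by
      rw [← hscore, col_dotProduct (S := S)]
      congr 1
      rw [hrw, dotProduct_add, residual_dotProduct_colsOn hu, zero_add]
    have h2 := hinc.abs_dotProduct_le (mul_nonneg hn'.le hlam.le) hon hj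
    have h3 : |n * score X y θ j| < n * lam := by
      rw [h1]
      refine (abs_add_le _ _).trans_lt ((add_lt_add_of_lt_of_le (hoff_noise j hj) h2).trans_eq ?_)
      ring
    rw [abs_mul, abs_of_pos hn'] at h3
    exact lt_of_mul_lt_mul_left h3 hn'.le
  obtain ⟨hsol, huniq⟩ := isSolution_and_unique hn hcmin heig hθoff
    (fun j => if hj : j ∈ S then (hkkt j hj).1 else (hlt j hj).le)
    (fun j => if hj : j ∈ S then (hkkt j hj).2 else by
      rw [hθoff j hj, abs_zero, mul_zero, mul_zero]) hlt
  refine ⟨θ, hsol, huniq, fun j hj => by_contra fun h => hj (hθoff j h), ?_⟩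
  refine (pi_norm_le_iff_of_nonneg (by positivity)).2 fun k => ?_
  -- Least squares recovers `w` from `X_S w`, which expresses the error through the noise and the
  -- fitted residual.
  have h1 : θ k - θstar k = leastSquares X S k ⬝ᵥ e - (leastSquares X S *ᵥ r) k := by
    have h2 : (leastSquares X S *ᵥ r) k = w k + leastSquares X S k ⬝ᵥ e := by
      rw [hrw, Matrix.mulVec_add, leastSquares_mulVec_colsOn hu]
      rfl
    rw [h2]
    simp only [hw]
    ring
  rw [Real.norm_eq_abs, h1]
  exact (abs_sub _ _).trans (add_le_add (hon_noise k)
    (hcurv.abs_leastSquares_le hn ha hα₁ hα₂ hlam.le hu hinc hon k))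

/-! ### Measurability of the random weights -/

theorem measurable_leastSquares {Ω : Type*} [MeasurableSpace Ω]
    {X : Ω → Matrix (Fin n) (Fin d) ℝ} (hX : ∀ i j, Measurable fun ω => X ω i j)
    (S : Finset (Fin d)) (k : S) (i : Fin n) :
    Measurable fun ω => leastSquares (X ω) S k i := by
  have h1 : ∀ i (k : S), Measurable fun ω => colsOn (X ω) S i k := fun i k => hX i k
  have h2 : ∀ (k : S) i, Measurable fun ω => (colsOn (X ω) S)ᵀ k i := fun k i => hX i k
  exact measurable_mul_apply (measurable_inv_apply (measurable_mul_apply h2 h1)) h2 k i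

theorem measurable_residual {Ω : Type*} [MeasurableSpace Ω]
    {X : Ω → Matrix (Fin n) (Fin d) ℝ} (hX : ∀ i j, Measurable fun ω => X ω i j)
    (S : Finset (Fin d)) (j : Fin d) (i : Fin n) :
    Measurable fun ω => residual (X ω) S j i := by
  refine (hX i j).sub (Finset.measurable_sum _ fun k _ => (hX i k).mul ?_)
  simp only [Matrix.mulVec, dotProduct]
  exact Finset.measurable_sum _
    fun l _ => (measurable_leastSquares hX S k l).mul
    (hX l j)

end Design

end Lasso

/-! ### Probability of the good event -/

theorem mainTheorem6 {Ω : Type*} [MeasurableSpace Ω] (μ : Measure Ω) [IsProbabilityMeasure μ]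
    (n d : ℕ) (S : Finset (Fin d)) (θstar : Fin d → ℝ)
    (β σ C α₁ α₂ a cmin : ℝ)
    (hβ : 0 < β) (hσ : 0 < σ) (hC : 0 < C) (hα₁ : α₁ < 1) (hα₂ : 0 < α₂) (ha : 0 ≤ a)
    (hcmin : 0 < cmin)
    (hθ_on : ∀ j ∈ S, β ≤ |θstar j|) (hθ_off : ∀ j, j ∉ S → θstar j = 0)
    (X : Ω → Matrix (Fin n) (Fin d) ℝ) (hX_meas : ∀ i j, Measurable (fun ω => X ω i j))
    (ε : Fin n → Ω → ℝ) (hε : Lasso.IsSubGaussianNoise μ ε σ)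
    (hXε : IndepFun (fun ω (p : Fin n × Fin d) => X ω p.1 p.2) (fun ω i => ε i ω) μ)
    (hX_norm : ∀ᵐ ω ∂μ, Lasso.ColumnNormalized (X ω) C)
    (hX_incoherence : ∀ᵐ ω ∂μ, Lasso.MutualIncoherence (X ω) S α₁)
    (hX_eigenvalue : ∀ᵐ ω ∂μ, Lasso.LowerEigenvalue (X ω) S cmin)
    (hX_curvature : ∀ᵐ ω ∂μ, Lasso.SupCurvature (X ω) S a α₂)
    (ζ lam B : ℝ)
    (hζ : ζ = 1 / 4 * min (√cmin / (σ * β)) (α₂ * (1 - α₁) / (2 * C * σ * β)))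
    (hlam : lam = 2 * C * σ / (1 - α₁) *
      (√(2 * Real.log ((d : ℝ) - (S.card : ℝ)) / (n : ℝ)) + ζ))
    (hB : B = σ / √cmin * (√(2 * Real.log (S.card : ℝ) / (n : ℝ)) + ζ) + 1 / α₂ * lam) :
    ∃ E : Set Ω, MeasurableSet E ∧
      1 - 4 * Real.exp (-((n : ℝ) * ζ ^ 2 / 2)) ≤ μ.real E ∧
      ∀ ω ∈ E, ∃ θhat : Fin d → ℝ,
        Lasso.IsSolution (X ω) (fun i => (X ω *ᵥ θstar) i + ε i ω) lam θhat ∧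
        (∀ θ : Fin d → ℝ,
          Lasso.IsSolution (X ω) (fun i => (X ω *ᵥ θstar) i + ε i ω) lam θ → θ = θhat) ∧
        (∀ j, θhat j ≠ 0 → j ∈ S) ∧
        ‖fun j : S => θhat j - θstar j‖ ≤ B := by
  rcases Nat.eq_zero_or_pos n with rfl | hn
  -- For `n = 0` the required probability is `1 - 4 < 0`, so the empty event suffices.
  · exact ⟨∅, MeasurableSet.empty, by simp, fun ω hω => hω.elim⟩
  have hn' : (0 : ℝ) < n := Nat.cast_pos.2 hn
  have hα : 0 < 1 - α₁ := sub_pos.2 hα₁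
  have hζ0 : 0 < ζ := by
    rw [hζ]
    have := Real.sqrt_pos.2 hcmin
    exact mul_pos (by norm_num) (lt_min (by positivity) (by positivity))
  have hlam0 : 0 < lam := by rw [hlam]; positivity
  have hcard : ((d : ℝ) - (S.card : ℝ)) = (Fintype.card {j // j ∉ S} : ℝ) := by
    rw [Fintype.card_subtype_compl, Fintype.card_fin, Fintype.card_coe,
      Nat.cast_sub (by simpa using S.card_le_univ)]
  set τ₁ := σ / √cmin * (√(2 * Real.log (S.card : ℝ) / (n : ℝ)) + ζ) with hτ₁
  -- Half of the admissible noise level, afforded by the factor 2 in `lam`. It turns the non-strict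
  -- complement of the tail event into the strict inequality that uniqueness needs.
  set τ₂ := n * (lam * (1 - α₁)) / 2 with hτ₂
  have hτ₁0 : 0 ≤ τ₁ := by positivity
  have hτ₂lt : τ₂ < n * (lam * (1 - α₁)) := half_lt_self (by positivity)
  have hunit : ∀ᵐ ω ∂μ, IsUnit ((Lasso.colsOn (X ω) S)ᵀ * Lasso.colsOn (X ω) S).det := by
    filter_upwards [hX_eigenvalue] with ω h
    exact Lasso.isUnit_det_of_lowerEigenvalue hn hcmin h
  -- Used to write the weights as measurable functions of the entries of `X`, so that they inherit
  -- independence from the noise.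
  have hentry : ∀ i j, Measurable fun x : Fin n × Fin d → ℝ =>
      (Matrix.of fun i j => x (i, j) : Matrix (Fin n) (Fin d) ℝ) i j :=
    fun i j => measurable_pi_apply (i, j)
  have hbad₁ : μ.real (⋃ k : S, {ω | τ₁ < |∑ i, Lasso.leastSquares (X ω) S k i * ε i ω|}) ≤
      2 * Real.exp (-(n * ζ ^ 2 / 2)) := by
    refine hε.measureReal_iUnion_le hσ hn (b := 1 / √cmin)
      (fun k => measurable_pi_lambda _ fun i => Lasso.measurable_leastSquares hX_meas S k i)
      (fun k => hXε.comp (measurable_pi_lambda _ fun i =>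
        Lasso.measurable_leastSquares hentry S k i) measurable_id) (by positivity)
      (fun k => ?_) hζ0.le ?_
    · filter_upwards [hX_eigenvalue] with ω h
      refine (Lasso.leastSquares_row_sq_le hn hcmin h k).trans_eq ?_
      rw [div_pow, one_pow, Real.sq_sqrt hcmin.le, div_div, mul_comm]
    · rw [hτ₁, Fintype.card_coe]
      ring
  have hbad₂ : μ.real (⋃ j : {j // j ∉ S},
      {ω | τ₂ < |∑ i, Lasso.residual (X ω) S j i * ε i ω|}) ≤
      2 * Real.exp (-(n * ζ ^ 2 / 2)) := by
    -- The value of `b` comes from the residual bound `C² n = (C n)² / n`; then `σ b (√(2 log (d -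
    -- s) / n) + ζ)` is exactly `τ₂`.
    refine hε.measureReal_iUnion_le hσ hn (b := C * n)
      (W := fun (j : {j // j ∉ S}) ω => Lasso.residual (X ω) S j)
      (fun j => measurable_pi_lambda _ fun i => Lasso.measurable_residual hX_meas S j i)
      (fun j => hXε.comp (measurable_pi_lambda _ fun i =>
        Lasso.measurable_residual hentry S j i) measurable_id) (by positivity)
      (fun j => ?_) hζ0.le ?_
    · filter_upwards [hX_norm, hunit] with ω h hu
      refine (Lasso.residual_sq_le_of_columnNormalized hn h hu j).trans_eq ?_
      field_simp
    · rw [hτ₂, hlam, hcard]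
      field_simp
  set A₁ := ⋃ k : S, {ω | τ₁ < |∑ i, Lasso.leastSquares (X ω) S k i * ε i ω|} with hA₁
  set A₂ := ⋃ j : {j // j ∉ S}, {ω | τ₂ < |∑ i, Lasso.residual (X ω) S j i * ε i ω|} with hA₂
  have hgood : ∀ᵐ ω ∂μ, Lasso.MutualIncoherence (X ω) S α₁ ∧
      Lasso.LowerEigenvalue (X ω) S cmin ∧ Lasso.SupCurvature (X ω) S a α₂ := by
    filter_upwards [hX_incoherence, hX_eigenvalue, hX_curvature] with ω h1 h2 h3
    exact ⟨h1, h2, h3⟩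
  set N := {ω | ¬(Lasso.MutualIncoherence (X ω) S α₁ ∧
      Lasso.LowerEigenvalue (X ω) S cmin ∧ Lasso.SupCurvature (X ω) S a α₂)} with hN
  have hN0 : μ.real N = 0 := by rw [Measure.real, show μ N = 0 from hgood, ENNReal.toReal_zero]
  -- `N` is known to be null but not to be measurable; a measurable hull of the bad set has the same
  -- measure and a measurable complement.
  have hsub := subset_toMeasurable μ (A₁ ∪ A₂ ∪ N)
  refine ⟨(toMeasurable μ (A₁ ∪ A₂ ∪ N))ᶜ, (measurableSet_toMeasurable _ _).compl, ?_,
    fun ω hω => ?_⟩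
  · rw [probReal_compl_eq_one_sub (measurableSet_toMeasurable _ _), Measure.real,
      measure_toMeasurable, ← Measure.real]
    have h1 := measureReal_union_le (μ := μ) (A₁ ∪ A₂) N
    have h2 := measureReal_union_le (μ := μ) A₁ A₂
    linarith
  · have hω' : ω ∉ A₁ ∪ A₂ ∪ N := fun h => hω (hsub h)
    rw [Set.mem_union, Set.mem_union, not_or, not_or] at hω'
    obtain ⟨⟨h₁, h₂⟩, h₃⟩ := hω'
    obtain ⟨hinc, heig, hcurv⟩ := not_not.1 h₃
    rw [hB]
    refine Lasso.exists_unique_solution_of_noise_bounds hn hα₁ hα₂ ha hcmin hlam0 hτ₁0 hθ_off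
      hinc heig hcurv (fun k => ?_) fun j hj => ?_
    · exact not_lt.1 fun h => h₁ (Set.mem_iUnion.2 ⟨k, h⟩)
    · exact (not_lt.1 fun h => h₂ (Set.mem_iUnion.2 ⟨⟨j, hj⟩, h⟩)).trans_lt hτ₂lt
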